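/- Fix a dimension $n$ and let $K=\mathbb{Q}$ or $K=\mathbb{Z}$. A \emph{transition system} in dimension $n$ over $K$ consists of a finite set $C$ of control states, an initial state $c_i\in C$ and a bad state $c_f\in C$, an initial valuation $x_0\in K^n$, and finitely many edges between control states. Each edge carries a guard, which is a finite conjunction of constraints $p(x)=0$, $p(x)\le 0$ or $p(x)<0$ with $p$ a polynomial in $n$ variables with coefficients in $K$, and a deterministic linear assignment $x:=Ax+b$ with $A\in K^{n\times n}$, $b\in K^n$. For $j,k\in C$ the transition relation $\tau_{j,k}\subseteq K^n\times K^n$ is the union, over the edges from $j$ to $k$, of $\{(x,Ax+b) : x \text{ satisfies the guard}\}$. A \emph{convex polyhedron over $K^n$} is the set of points of $K^n$ satisfying a finite (possibly empty) system of non-strict linear inequalities with coefficients in $K$. For a class $\mathcal{D}$ of subsets of $K^n$, the \emph{inductive separation problem} for $\mathcal{D}$ in dimension $n$ over $K$ is: given a transition system in dimension $n$ over $K$, all of whose data are explicitly given finite objects, decide whether there is a family $(I(c))_{c\in C}$ of members of $\mathcal{D}$ such that $x_0\in I(c_i)$, $I(c_f)=\emptyset$, and for all $j,k\in C$ and $x,x'\in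 K^n$, if $x\in I(j)$ and $(x,x')\in\tau_{j,k}$ then $x'\in I(k)$. \textbf{Theorem.} There is $n_0$ such that for every fixed $n\ge n_0$ the inductive separation problem in dimension $n$ is algorithmically undecidable in each of the following four cases: $K=\mathbb{Q}$ and $\mathcal{D}$ the set of all convex polyhedra over $\mathbb{Q}^n$; $K=\mathbb{Q}$ and $\mathcal{D}$ the set of all bounded convex polyhedra over $\mathbb{Q}^n$; $K=\mathbb{Z}$ and $\mathcal{D}$ the set of all convex polyhedra over $\mathbb{Z}^n$; $K=\mathbb{Z}$ and $\mathcal{D}$ the set of all bounded convex polyhedra over $\mathbb{Z}^n$. -/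

import Mathlib

namespace PolyInv

/-! ## Inductive separating invariants and classes of polyhedra -/

/-- `I` labels every control state with a member of the class `D`, contains the initial valuation
`x₀` at `ci`, labels `cf` with the empty set, and is stable under the transition relations `τ`. -/
structure IsInductiveSeparating {K : Type} {n : ℕ} {C : Type} (D : Set (Set (Fin n → K)))
    (τ : C → C → (Fin n → K) → (Fin n → K) → Prop) (ci cf : C) (x₀ : Fin n → K)
    (I : C → Set (Fin n → K)) : Prop where
  mem_class : ∀ c, I c ∈ D
  init_mem : x₀ ∈ I ci
  bad_empty : I cf = ∅
  stable : ∀ j k : C, ∀ x x' : Fin n → K, x ∈ I j → τ j k x x' → x' ∈ I k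

/-- The convex polyhedra over `Kⁿ`: solution sets in `Kⁿ` of finite systems of (non-strict) linear
inequalities `∑ i, a i * x i ≤ b` with coefficients in `K` (an equality is a pair of inequalities;
over `ℤ`, rational coefficients give the same sets, by clearing denominators). -/
def convexPolyhedra (K : Type) [CommRing K] [LinearOrder K] (n : ℕ) : Set (Set (Fin n → K)) :=
  {P | ∃ L : List ((Fin n → K) × K), P = {x | ∀ c ∈ L, ∑ i, c.1 i * x i ≤ c.2}}

/-- The bounded convex polyhedra over `Kⁿ`. -/
def boundedConvexPolyhedra (K : Type) [CommRing K] [LinearOrder K] (n : ℕ) :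
    Set (Set (Fin n → K)) :=
  {P | P ∈ convexPolyhedra K n ∧ ∃ B : K, ∀ x ∈ P, ∀ i, |x i| ≤ B}

/-! ## Finite descriptions of transition systems

`R` is the type of numerals used in the description; a map `v : R → K` gives their values. -/

/-- Comparison symbols in guards. -/
inductive Cmp where
  | eq
  | le
  | lt

/-- `p ⋈ 0`. -/
def Cmp.holds {K : Type} [Zero K] [LT K] [LE K] : Cmp → K → Prop
  | .eq, a => a = 0
  | .le, a => a ≤ 0
  | .lt, a => a < 0

/-- A polynomial in `n` variables, written as a list of monomials
(coefficient, vector of exponents). -/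
abbrev Poly (R : Type) (n : ℕ) : Type := List (R × (Fin n → ℕ))

/-- Value of a polynomial at a point. -/
def Poly.eval {R K : Type} [CommRing K] {n : ℕ} (v : R → K) (p : Poly R n) (x : Fin n → K) : K :=
  (p.map fun m => v m.1 * ∏ i, x i ^ m.2 i).sum

/-- A guarded edge of the control flow graph: source and target control states, a guard (a
conjunction of polynomial constraints `p ⋈ 0`), and a deterministic linear assignment
`x := mat * x + vec`. -/
structure Edge (R : Type) (n : ℕ) where
  src : ℕ
  tgt : ℕ
  guard : List (Cmp × Poly R n)
  mat : Fin n → Fin n → R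
  vec : Fin n → R

/-- The relation between valuations before and after taking the edge. -/
def Edge.rel {R K : Type} [CommRing K] [LinearOrder K] {n : ℕ} (v : R → K) (e : Edge R n)
    (x x' : Fin n → K) : Prop :=
  (∀ g ∈ e.guard, g.1.holds (g.2.eval v x)) ∧
    ∀ i, x' i = ∑ j, v (e.mat i j) * x j + v (e.vec i)

/-- A transition system with `n` variables: finitely many guarded edges, an initial control state,
a bad control state and an initial valuation. Control states are named by natural numbers. -/
structure System (R : Type) (n : ℕ) where
  init : ℕ
  bad : ℕ
  start : Fin n → R
  edges : List (Edge R n)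

namespace System

variable {R : Type} {n : ℕ}

/-- The (finite) set of control states: the initial one, the bad one, and all ends of edges. -/
def controlStates (S : System R n) : Finset ℕ :=
  insert S.init (insert S.bad (S.edges.map Edge.src ++ S.edges.map Edge.tgt).toFinset)

theorem init_mem (S : System R n) : S.init ∈ S.controlStates := by
  simp [controlStates]

theorem bad_mem (S : System R n) : S.bad ∈ S.controlStates := by
  simp [controlStates]

/-- The transition relation `τ j k`: the union of the relations of the edges from `j` to `k`. -/
def trans {K : Type} [CommRing K] [LinearOrder K] (v : R → K) (S : System R n) (j k : ℕ)
    (x x' : Fin n → K) : Prop :=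
  ∃ e ∈ S.edges, e.src = j ∧ e.tgt = k ∧ e.rel v x x'

/-- The system, with numerals read through `v`, has an inductive separating invariant
all of whose labels are in the class `D`. -/
def HasSeparatingInvariant {K : Type} [CommRing K] [LinearOrder K] (v : R → K)
    (D : Set (Set (Fin n → K))) (S : System R n) : Prop :=
  ∃ I : S.controlStates → Set (Fin n → K),
    IsInductiveSeparating D (fun j k => S.trans v j.1 k.1) ⟨S.init, S.init_mem⟩ ⟨S.bad, S.bad_mem⟩
      (fun i => v (S.start i)) I

end System

/-! ## Numerals -/

/-- Rational numerals: `(a, d)` denotes the fraction `a / (d + 1)`. -/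
def ratValue (q : ℤ × ℕ) : ℚ := (q.1 : ℚ) / ((q.2 : ℚ) + 1)

/-! ## Descriptions as inputs of algorithms -/

/-- Comparison symbols as elements of a three-element type. -/
def Cmp.equivFin : Cmp ≃ Fin 3 where
  toFun
    | .eq => 0
    | .le => 1
    | .lt => 2
  invFun
    | 0 => .eq
    | 1 => .le
    | 2 => .lt
  left_inv := by rintro (_ | _ | _) <;> rfl
  right_inv := by intro i; fin_cases i <;> rfl

/-- An edge as the tuple of its components. -/
def Edge.equivProd (R : Type) (n : ℕ) :
    Edge R n ≃ ℕ × ℕ × List (Cmp × Poly R n) × (Fin n → Fin n → R) × (Fin n → R) where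
  toFun e := (e.src, e.tgt, e.guard, e.mat, e.vec)
  invFun t := ⟨t.1, t.2.1, t.2.2.1, t.2.2.2.1, t.2.2.2.2⟩
  left_inv _ := rfl
  right_inv _ := rfl

/-- A system as the tuple of its components. -/
def System.equivProd (R : Type) (n : ℕ) :
    System R n ≃ ℕ × ℕ × (Fin n → R) × List (Edge R n) where
  toFun S := (S.init, S.bad, S.start, S.edges)
  invFun t := ⟨t.1, t.2.1, t.2.2.1, t.2.2.2⟩
  left_inv _ := rfl
  right_inv _ := rfl

instance Cmp.instPrimcodable : Primcodable Cmp :=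
  Primcodable.ofEquiv (Fin 3) Cmp.equivFin

instance Edge.instPrimcodable (R : Type) [Primcodable R] (n : ℕ) : Primcodable (Edge R n) :=
  Primcodable.ofEquiv _ (Edge.equivProd R n)

instance System.instPrimcodable (R : Type) [Primcodable R] (n : ℕ) : Primcodable (System R n) :=
  Primcodable.ofEquiv _ (System.equivProd R n)

/-! ## The decision problems in dimension `n` -/

/-- The inductive separation problem over `ℚⁿ` for the class `D`. -/
def RatSeparation (n : ℕ) (D : Set (Set (Fin n → ℚ))) (S : System (ℤ × ℕ) n) : Prop :=
  S.HasSeparatingInvariant ratValue D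

/-- The inductive separation problem over `ℤⁿ` for the class `D`. -/
def IntSeparation (n : ℕ) (D : Set (Set (Fin n → ℤ))) (S : System ℤ n) : Prop :=
  S.HasSeparatingInvariant id D

end PolyInv

/-!
A separation problem in dimension `n ≥ 8` can encode the halting problem, by a reduction that works
at once for every ordered ring `K` in play and every class between the bounded and all convex
polyhedra.

*Machine.* A fixed code `c` for a universal partial recursive function is executed by Mathlib's
machine with four stacks. Its stacks become numbers in base `5`. Pushing is affine; popping is a
division by `5`, carried out by repeated subtraction, so that all updates are affine with integer
coefficients (`regStep_respects`). The finitely many program points are numbered and stored in a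
register, and each instruction becomes an edge of control state `0` (`machineEdges_rel`,
`exists_machineEdges_rel`). Only the initial valuation depends on the input.

*Clock.* Two further coordinates hold the time `t` and `s = t ^ 2`; the latter has the affine update
`s + 2 t + 1`. All edges of the machine have the guard `s = t ^ 2`. An edge copies `(t, s)` to
control state `1`, from where the bad state is reached if `t = 0` and `s = 1`.

*Infinite runs.* The label of control state `1` contains `(j, j ^ 2)` for all natural `j`. A
linear inequality `a t + b s ≤ d` that holds at all these points has `b ≤ 0 ≤ d`, so it holds at
`(0, 1)` too, and the bad state cannot have an empty label
(`not_hasSeparatingInvariant_of_infinite`).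

*Finite runs.* Points on a parabola are in convex position. If the run ends at time `N`, a bounded
polyhedron can thus contain the configurations reached and no other point with `s = t ^ 2`:
the chords of the parabola force `t` to be one of the integers `0, …, N`, and
the bounds `|x i - X k i| ≤ M (s - 2 k t + k ^ 2)` force `x = X k` where `t = k`, since their
right-hand side is `M (t - k) ^ 2` on the parabola. No other point of the polyhedron enables an edge
of the machine, so the polyhedron is inductive (`hasSeparatingInvariant_of_finite`).
-/

namespace PolyInv

/-! ### Invariants as labellings of all natural numbers -/

theorem System.hasSeparatingInvariant_iff {R K : Type} [CommRing K] [LinearOrder K] {n : ℕ}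
    (v : R → K) (D : Set (Set (Fin n → K))) (S : System R n) :
    S.HasSeparatingInvariant v D ↔ ∃ I : ℕ → Set (Fin n → K), (∀ c, I c ∈ D) ∧
      (fun i => v (S.start i)) ∈ I S.init ∧ I S.bad = ∅ ∧
      ∀ e ∈ S.edges, ∀ x x', x ∈ I e.src → e.rel v x x' → x' ∈ I e.tgt := by
  constructor
  · rintro ⟨I, hI⟩
    have hb := hI.bad_empty
    refine ⟨fun c => if h : c ∈ S.controlStates then I ⟨c, h⟩ else ∅, fun c => ?_, ?_, ?_, ?_⟩
    · dsimp only
      split_ifs with h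
      · exact hI.mem_class _
      · exact hb ▸ hI.mem_class _
    · simpa [S.init_mem] using hI.init_mem
    · simpa [S.bad_mem] using hb
    · intro e he x x' hx hr
      have hs : e.src ∈ S.controlStates := by
        simp only [System.controlStates, Finset.mem_insert, List.mem_toFinset, List.mem_append,
          List.mem_map]
        exact .inr (.inr (.inl ⟨e, he, rfl⟩))
      have ht : e.tgt ∈ S.controlStates := by
        simp only [System.controlStates, Finset.mem_insert, List.mem_toFinset, List.mem_append,
          List.mem_map]
        exact .inr (.inr (.inr ⟨e, he, rfl⟩))
      simp only [hs, ht, dif_pos] at hx ⊢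
      exact hI.stable ⟨_, hs⟩ ⟨_, ht⟩ x x' hx ⟨e, he, rfl, rfl, hr⟩
  · rintro ⟨I, hD, hi, hb, hst⟩
    refine ⟨fun c => I c.1, fun c => hD _, hi, hb, ?_⟩
    rintro j k x x' hx ⟨e, he, hj, hk, hr⟩
    rw [← hj] at hx
    rw [← hk]
    exact hst e he x x' hx hr

/-! ### Renaming of numerals -/

/-- The edge obtained by rewriting all numerals through `ι`. -/
def Edge.map {R R' : Type} {n : ℕ} (ι : R → R') (e : Edge R n) : Edge R' n where
  src := e.src
  tgt := e.tgt
  guard := e.guard.map fun g => (g.1, g.2.map fun m => (ι m.1, m.2))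
  mat i j := ι (e.mat i j)
  vec i := ι (e.vec i)

/-- The system obtained by rewriting all numerals through `ι`. -/
def System.map {R R' : Type} {n : ℕ} (ι : R → R') (S : System R n) : System R' n where
  init := S.init
  bad := S.bad
  start i := ι (S.start i)
  edges := S.edges.map (Edge.map ι)

theorem Edge.rel_map {R R' K : Type} [CommRing K] [LinearOrder K] {n : ℕ} (ι : R → R')
    (v : R' → K) (e : Edge R n) (x x' : Fin n → K) :
    (e.map ι).rel v x x' ↔ e.rel (fun r => v (ι r)) x x' := by
  simp only [Edge.rel, Edge.map, Poly.eval, List.forall_mem_map, List.map_map, Function.comp_def]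

theorem System.hasSeparatingInvariant_map {R R' K : Type} [CommRing K] [LinearOrder K] {n : ℕ}
    (ι : R → R') (v : R' → K) (D : Set (Set (Fin n → K))) (S : System R n) :
    (S.map ι).HasSeparatingInvariant v D ↔ S.HasSeparatingInvariant (fun r => v (ι r)) D := by
  rw [System.hasSeparatingInvariant_iff, System.hasSeparatingInvariant_iff]
  simp only [System.map, List.forall_mem_map, Edge.rel_map]
  rfl

/-! ### Integer edges at integer points of an ordered ring -/

section Cast

variable {K : Type} [CommRing K] {n : ℕ}

theorem Poly.eval_intCast (p : Poly ℤ n) (x : Fin n → ℤ) :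
    p.eval (fun z : ℤ => (z : K)) (fun i => (x i : K)) = ((p.eval (fun z => z) x : ℤ) : K) := by
  unfold Poly.eval
  induction p with
  | nil => simp
  | cons m p ih => simp [ih]

variable [LinearOrder K] [IsStrictOrderedRing K]

theorem Cmp.holds_intCast (c : Cmp) (a : ℤ) : c.holds (a : K) ↔ c.holds a := by
  cases c <;> simp [Cmp.holds]

theorem Edge.rel_intCast (e : Edge ℤ n) (x : Fin n → ℤ) (x' : Fin n → K) :
    e.rel (fun z : ℤ => (z : K)) (fun i => (x i : K)) x' ↔
      ∃ y, e.rel (fun z => z) x y ∧ x' = fun i => (y i : K) := by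
  unfold Edge.rel
  simp only [Poly.eval_intCast, Cmp.holds_intCast]
  constructor
  · rintro ⟨hg, hx⟩
    refine ⟨fun i => ∑ j, e.mat i j * x j + e.vec i, ⟨hg, fun _ => rfl⟩, ?_⟩
    ext i
    simp [hx]
  · rintro ⟨y, ⟨hg, hy⟩, rfl⟩
    exact ⟨hg, fun i => by simp [hy]⟩

end Cast

/-! ### Polyhedra -/

section Polyhedra

variable {K : Type} [CommRing K] [LinearOrder K] {n : ℕ}

theorem halfspace_mem (a : Fin n → K) (b : K) :
    {x | ∑ i, a i * x i ≤ b} ∈ convexPolyhedra K n := ⟨[(a, b)], by simp⟩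

theorem univ_mem : Set.univ ∈ convexPolyhedra K n := ⟨[], by simp⟩

theorem inter_mem {P Q : Set (Fin n → K)} (hP : P ∈ convexPolyhedra K n)
    (hQ : Q ∈ convexPolyhedra K n) : P ∩ Q ∈ convexPolyhedra K n := by
  obtain ⟨L, rfl⟩ := hP
  obtain ⟨M, rfl⟩ := hQ
  refine ⟨L ++ M, ?_⟩
  ext x
  simp only [Set.mem_inter_iff, Set.mem_ofPred_eq, List.mem_append, or_imp, forall_and]

theorem iInter_mem {α : Type} (s : Finset α) {P : α → Set (Fin n → K)}
    (hP : ∀ a ∈ s, P a ∈ convexPolyhedra K n) :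
    {x | ∀ a ∈ s, x ∈ P a} ∈ convexPolyhedra K n := by
  classical
  induction s using Finset.induction_on with
  | empty => simpa using univ_mem
  | insert a s ha ih =>
    have := inter_mem (hP a (by simp)) (ih fun b hb => hP b (by simp [hb]))
    convert this using 1
    ext x
    simp

/-- A linear inequality in three coordinates (which need not be distinct). -/
theorem affine_mem (i j k : Fin n) (a b c d : K) :
    {x : Fin n → K | a * x i + b * x j + c * x k ≤ d} ∈ convexPolyhedra K n := by
  have := halfspace_mem (K := K)
    (fun l => (if l = i then a else 0) + (if l = j then b else 0) + if l = k then c else 0) d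
  convert this using 2
  ext x
  simp [add_mul, Finset.sum_add_distrib]

variable [IsStrictOrderedRing K]

theorem empty_mem : ∅ ∈ convexPolyhedra K n := by
  refine ⟨[(0, -1)], ?_⟩
  ext x
  simp

/-- A polyhedron that contains all points of the parabola with natural abscissa (the other
coordinates being `0`) contains a point off the parabola above its vertex: every inequality
`a x + b y ≤ d` valid on these points has `b ≤ 0 ≤ d`. -/
theorem above_vertex_mem [Archimedean K] {P : Set (Fin n → K)} (hP : P ∈ convexPolyhedra K n)
    {t s : Fin n} (hts : t ≠ s)
    (h : ∀ j : ℕ, (fun i => if i = t then (j : K) else if i = s then (j : K) ^ 2 else 0) ∈ P) :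
    (fun i => if i = t then 0 else if i = s then 1 else 0) ∈ P := by
  obtain ⟨L, rfl⟩ := hP
  intro c hc
  have key : ∀ p q : K, ∑ i, c.1 i * (if i = t then p else if i = s then q else 0)
      = c.1 t * p + c.1 s * q := by
    intro p q
    have : ∀ i, c.1 i * (if i = t then p else if i = s then q else 0)
        = (if i = t then c.1 t * p else 0) + (if i = s then c.1 s * q else 0) := by
      intro i
      by_cases hit : i = t
      · subst hit; simp [hts]
      · by_cases his : i = s <;> simp [hit, his]
        subst his; simp [hit]
    simp [this, Finset.sum_add_distrib]
  have h' : ∀ j : ℕ, c.1 t * j + c.1 s * (j : K) ^ 2 ≤ c.2 := fun j => by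
    rw [← key]; exact h j c hc
  rw [key]
  have h0 : 0 ≤ c.2 := by simpa using h' 0
  suffices c.1 s ≤ 0 by linarith
  by_contra! hpos
  obtain ⟨m, hm⟩ := Archimedean.arch (|c.1 t| + c.2 + 1) hpos
  rw [nsmul_eq_mul] at hm
  have h1 := h' (m + 1)
  push_cast at h1
  have hm0 : (0 : K) ≤ m := Nat.cast_nonneg m
  have habs : -|c.1 t| ≤ c.1 t := neg_abs_le _
  -- the slope `c.1 t + c.1 s * j` exceeds `c.2` for `j = m + 1`
  have h2 : c.2 + 1 ≤ c.1 t + c.1 s * (m + 1) := by nlinarith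
  nlinarith [mul_le_mul_of_nonneg_left h2 (by linarith : (0 : K) ≤ (m : K) + 1)]

end Polyhedra

/-! ### A clocked machine and its parabola -/

section Clock

variable {n : ℕ}

/-- The polynomial `s - t ^ 2`. -/
def parabola (t s : Fin n) : Poly ℤ n := [(1, Pi.single s 1), (-1, Pi.single t 2)]

theorem prod_pow_single {K : Type} [CommRing K] (x : Fin n → K) (t : Fin n) (m : ℕ) :
    ∏ i, x i ^ (Pi.single t m : Fin n → ℕ) i = x t ^ m := by
  rw [Finset.prod_eq_single t] <;> simp +contextual

theorem eval_parabola {K : Type} [CommRing K] (t s : Fin n) (x : Fin n → K) :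
    (parabola t s).eval (fun z : ℤ => (z : K)) x = x s - x t ^ 2 := by
  simp [parabola, Poly.eval, prod_pow_single, sub_eq_add_neg]

/-- The edge from control state `0` to control state `1` that keeps the coordinates `t` and `s` and
erases all others. -/
def projectEdge (t s : Fin n) : Edge ℤ n where
  src := 0
  tgt := 1
  guard := []
  mat i j := if i = j ∧ (i = t ∨ i = s) then 1 else 0
  vec _ := 0

/-- The edge from control state `1` to the bad control state `2`, enabled where `t = 0` and
`s = 1`. -/
def badEdge (t s : Fin n) : Edge ℤ n where
  src := 1
  tgt := 2
  guard := [(.eq, [(1, Pi.single t 1)]), (.eq, [(1, Pi.single s 1), (-1, 0)])]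
  mat _ _ := 0
  vec _ := 0

theorem projectEdge_rel {K : Type} [CommRing K] [LinearOrder K] (t s : Fin n) (x x' : Fin n → K) :
    (projectEdge t s).rel (fun z : ℤ => (z : K)) x x' ↔
      x' = fun i => if i = t then x t else if i = s then x s else 0 := by
  simp only [Edge.rel, projectEdge, List.not_mem_nil, false_implies, implies_true, true_and,
    funext_iff]
  refine forall_congr' fun i => ?_
  by_cases ht : i = t
  · simp [ht]
  · by_cases hs : i = s
    · subst hs; simp [ht]
    · simp [ht, hs]

theorem badEdge_rel {K : Type} [CommRing K] [LinearOrder K] (t s : Fin n) (x x' : Fin n → K) :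
    (badEdge t s).rel (fun z : ℤ => (z : K)) x x' ↔ x t = 0 ∧ x s = 1 ∧ x' = 0 := by
  simp [Edge.rel, badEdge, Poly.eval, Cmp.holds, prod_pow_single, funext_iff, and_assoc,
    add_neg_eq_zero]

/-- The system that runs the edges `E` in control state `0`, copies the clock `t` and its square
`s` to control state `1`, and watches there for the point `t = 0`, `s = 1`. -/
def clockSystem (t s : Fin n) (E : List (Edge ℤ n)) (x₀ : Fin n → ℤ) : System ℤ n where
  init := 0
  bad := 2
  start := x₀
  edges := E ++ [projectEdge t s, badEdge t s]

variable {K : Type} [CommRing K] [LinearOrder K] [IsStrictOrderedRing K]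

/-- If the machine runs forever, no polyhedral invariant separates: the label of control state `1`
contains all points `(j, j ^ 2)`. -/
theorem not_hasSeparatingInvariant_of_infinite [Archimedean K] {t s : Fin n} (hts : t ≠ s)
    {E : List (Edge ℤ n)} {X : ℕ → Fin n → ℤ} (ht : ∀ j, X j t = j) (hs : ∀ j, X j s = (j : ℤ) ^ 2)
    (hE : ∀ e ∈ E, e.src = 0 ∧ e.tgt = 0)
    (hstep : ∀ j, ∃ e ∈ E, e.rel (fun z => z) (X j) (X (j + 1))) :
    ¬ (clockSystem t s E (X 0)).HasSeparatingInvariant (fun z : ℤ => (z : K))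
      (convexPolyhedra K n) := by
  rw [System.hasSeparatingInvariant_iff]
  rintro ⟨I, hD, hi, hb, hst⟩
  have hrun : ∀ j, (fun i => (X j i : K)) ∈ I 0 := by
    intro j
    induction j with
    | zero => exact hi
    | succ j ih =>
      obtain ⟨e, he, hr⟩ := hstep j
      obtain ⟨h0, h1⟩ := hE e he
      rw [← h1]
      exact hst e (by simp [clockSystem, he]) _ _ (h0 ▸ ih)
        ((Edge.rel_intCast e _ _).2 ⟨_, hr, rfl⟩)
  have hproj : ∀ j : ℕ,
      (fun i => if i = t then (j : K) else if i = s then (j : K) ^ 2 else 0) ∈ I 1 := by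
    intro j
    refine hst (projectEdge t s) (by simp [clockSystem]) _ _ (hrun j) ?_
    rw [projectEdge_rel]
    simp [ht, hs]
  have := hst (badEdge t s) (by simp [clockSystem]) _ 0 (above_vertex_mem (hD 1) hts hproj)
    ((badEdge_rel t s _ _).2 (by simp [hts.symm]))
  exact (hb ▸ this : (0 : Fin n → K) ∈ (∅ : Set _))

/-- The polygon with vertices `(k, k ^ 2)`, `k ≤ N`, in the plane of the coordinates `t` and `s`. -/
def clockPolygon (K : Type) [CommRing K] [LinearOrder K] (t s : Fin n) (N : ℕ) :
    Set (Fin n → K) :=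
  {x | 0 ≤ x t ∧ x t ≤ N ∧ 0 ≤ x s ∧ x s ≤ N * x t ∧
    ∀ k ∈ Finset.range N, (2 * k + 1) * x t - k * (k + 1) ≤ x s}

theorem clockPolygon_mem (t s : Fin n) (N : ℕ) : clockPolygon K t s N ∈ convexPolyhedra K n := by
  have h1 := affine_mem (K := K) t t t (-1) 0 0 0
  have h2 := affine_mem (K := K) t t t 1 0 0 N
  have h3 := affine_mem (K := K) s s s (-1) 0 0 0
  have h4 := affine_mem (K := K) s t t 1 (-N) 0 0
  have h5 := iInter_mem (Finset.range N) (P := fun k : ℕ => {x : Fin n → K |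
    (2 * k + 1) * x t + (-1) * x s + 0 * x s ≤ k * (k + 1)}) fun k _ => affine_mem _ _ _ _ _ _ _
  have := inter_mem h1 (inter_mem h2 (inter_mem h3 (inter_mem h4 h5)))
  convert this using 1
  ext x
  simp only [clockPolygon, Set.mem_ofPred_eq, Set.mem_inter_iff]
  refine and_congr ?_ (and_congr ?_ (and_congr ?_ (and_congr ?_ (forall₂_congr fun k _ => ?_)))) <;>
    constructor <;> intro h <;> linarith

/-- The chord inequalities leave only the vertices of the polygon on the parabola. -/
theorem eq_natCast_of_mem_clockPolygon {t s : Fin n} {N : ℕ} {x : Fin n → K}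
    (hx : x ∈ clockPolygon K t s N) (hp : x s = x t ^ 2) : ∃ j ≤ N, x t = j := by
  obtain ⟨h0, hN, -, -, hk⟩ := hx
  induction N with
  | zero => exact ⟨0, le_rfl, by simpa using le_antisymm (by simpa using hN) h0⟩
  | succ N ih =>
    have h := hk N (by simp)
    rw [hp] at h
    rcases le_or_gt (x t) N with hle | hlt
    · obtain ⟨j, hj, hjt⟩ := ih hle fun k hk' => hk k (by simp at hk' ⊢; omega)
      exact ⟨j, by omega, hjt⟩
    · refine ⟨N + 1, le_rfl, le_antisymm hN ?_⟩
      push_cast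
      -- `(x t - N) * (x t - (N + 1)) ≥ 0` and the first factor is positive
      have : 0 ≤ (x t - N) * (x t - (N + 1)) := by nlinarith
      have := nonneg_of_mul_nonneg_right this (by linarith)
      linarith

/-- The polyhedron cut out of the cylinder over the clock polygon by bounding the distance of all
coordinates from `X k` by a multiple of the linear function `s - 2 k t + k ^ 2`, which equals
`(t - k) ^ 2` on the parabola. -/
def runPolyhedron (K : Type) [CommRing K] [LinearOrder K] (t s : Fin n) (N M : ℕ)
    (X : ℕ → Fin n → ℤ) : Set (Fin n → K) :=
  {x | x ∈ clockPolygon K t s N ∧ ∀ p ∈ Finset.range (N + 1) ×ˢ (Finset.univ : Finset (Fin n)),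
    x p.2 - X p.1 p.2 ≤ M * (x s - 2 * p.1 * x t + p.1 ^ 2) ∧
      X p.1 p.2 - x p.2 ≤ M * (x s - 2 * p.1 * x t + p.1 ^ 2)}

theorem runPolyhedron_mem (t s : Fin n) (N M : ℕ) (X : ℕ → Fin n → ℤ) :
    runPolyhedron K t s N M X ∈ convexPolyhedra K n := by
  refine inter_mem (clockPolygon_mem t s N) (iInter_mem _ (P := fun p : ℕ × Fin n =>
    {x : Fin n → K | x p.2 - X p.1 p.2 ≤ M * (x s - 2 * p.1 * x t + p.1 ^ 2) ∧
      X p.1 p.2 - x p.2 ≤ M * (x s - 2 * p.1 * x t + p.1 ^ 2)}) fun p _ => ?_)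
  have h1 := affine_mem (K := K) p.2 s t 1 (-M) (M * (2 * p.1)) (X p.1 p.2 + M * p.1 ^ 2)
  have h2 := affine_mem (K := K) p.2 s t (-1) (-M) (M * (2 * p.1)) (-X p.1 p.2 + M * p.1 ^ 2)
  convert inter_mem h1 h2 using 1
  ext x
  simp only [Set.mem_ofPred_eq, Set.mem_inter_iff]
  refine and_congr ?_ ?_ <;> constructor <;> intro h <;> linarith

theorem eq_of_mem_runPolyhedron {t s : Fin n} {N M : ℕ} {X : ℕ → Fin n → ℤ} {x : Fin n → K}
    (hx : x ∈ runPolyhedron K t s N M X) (hp : x s = x t ^ 2) :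
    ∃ j ≤ N, x = fun i => (X j i : K) := by
  obtain ⟨j, hj, hjt⟩ := eq_natCast_of_mem_clockPolygon hx.1 hp
  refine ⟨j, hj, funext fun i => ?_⟩
  obtain ⟨h1, h2⟩ := hx.2 (j, i) (by simp; omega)
  have : x s - 2 * j * x t + j ^ 2 = 0 := by rw [hp, hjt]; ring
  simp only [this, mul_zero] at h1 h2
  linarith

theorem mem_clockPolygon_of_le {t s : Fin n} {N j : ℕ} (hj : j ≤ N) {x : Fin n → K}
    (ht : x t = j) (hs : x s = (j : K) ^ 2) : x ∈ clockPolygon K t s N := by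
  have hjN : (j : K) ≤ N := by exact_mod_cast hj
  have hj0 : (0 : K) ≤ j := Nat.cast_nonneg j
  refine ⟨by rw [ht]; exact hj0, by rw [ht]; exact hjN, by rw [hs]; positivity, ?_, ?_⟩
  · rw [hs, ht]; nlinarith
  · intro k _
    rw [hs, ht]
    have : (0 : ℤ) ≤ ((j : ℤ) - k) * (j - k - 1) := by
      rcases le_or_gt (j : ℤ) k with h | h
      · exact mul_nonneg_of_nonpos_of_nonpos (by omega) (by omega)
      · exact mul_nonneg (by omega) (by omega)
    have : (0 : K) ≤ ((j : K) - k) * (j - k - 1) := by exact_mod_cast this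
    linarith

theorem mem_runPolyhedron {t s : Fin n} {N M j : ℕ} {X : ℕ → Fin n → ℤ}
    (ht : ∀ j, X j t = j) (hs : ∀ j, X j s = (j : ℤ) ^ 2)
    (hM : ∀ j ≤ N, ∀ k ≤ N, ∀ i, |X j i - X k i| ≤ M) (hj : j ≤ N) :
    (fun i => (X j i : K)) ∈ runPolyhedron K t s N M X := by
  refine ⟨mem_clockPolygon_of_le hj (by simp [ht]) (by simp [hs]), ?_⟩
  rintro ⟨k, i⟩ hk
  have hk : k ≤ N := by simp at hk; omega
  have key : |X j i - X k i| ≤ M * (X j s - 2 * k * X j t + k ^ 2) := by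
    have h2 : X j s - 2 * k * X j t + k ^ 2 = ((j : ℤ) - k) ^ 2 := by rw [ht, hs]; ring
    rw [h2]
    rcases eq_or_ne j k with rfl | hne
    · simp
    · have : (1 : ℤ) ≤ ((j : ℤ) - k) ^ 2 := by
        have : ((j : ℤ) - k) ≠ 0 := by omega
        have := sq_pos_of_ne_zero this
        omega
      have := hM j hj k hk i
      nlinarith
  constructor
  · dsimp only
    exact_mod_cast (le_abs_self _).trans key
  · have := (neg_le_abs (X j i - X k i)).trans key
    rw [neg_sub] at this
    dsimp only
    exact_mod_cast this

theorem runPolyhedron_bounded (t s : Fin n) (N M : ℕ) (X : ℕ → Fin n → ℤ) :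
    ∃ B : K, ∀ x ∈ runPolyhedron K t s N M X, ∀ i, |x i| ≤ B := by
  refine ⟨∑ i, |(X 0 i : K)| + M * (N * N), fun x hx i => ?_⟩
  obtain ⟨h1, h2⟩ := hx.2 (0, i) (by simp)
  obtain ⟨-, htN, -, hs, -⟩ := hx.1
  have hi : |(X 0 i : K)| ≤ ∑ i, |(X 0 i : K)| :=
    Finset.single_le_sum (f := fun i => |(X 0 i : K)|) (fun _ _ => abs_nonneg _)
      (Finset.mem_univ i)
  have hsN : (M : K) * x s ≤ M * (N * N) := by gcongr; exact hs.trans (by gcongr)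
  simp at h1 h2
  have h3 := abs_le.1 (le_refl |(X 0 i : K)|)
  rw [abs_le]
  constructor <;> linarith

/-- If the machine stops, its finitely many configurations are the only points of the run
polyhedron on the parabola, which makes this polyhedron inductive. -/
theorem hasSeparatingInvariant_of_finite {t s : Fin n} (hts : t ≠ s)
    {E : List (Edge ℤ n)} {X : ℕ → Fin n → ℤ} (ht : ∀ j, X j t = j) (hs : ∀ j, X j s = (j : ℤ) ^ 2)
    (hE : ∀ e ∈ E, e.src = 0 ∧ e.tgt = 0 ∧ (Cmp.eq, parabola t s) ∈ e.guard) (N : ℕ)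
    (hstep : ∀ j < N, ∀ e ∈ E, ∀ y, e.rel (fun z => z) (X j) y → y = X (j + 1))
    (hlast : ∀ e ∈ E, ∀ y, ¬ e.rel (fun z => z) (X N) y) :
    (clockSystem t s E (X 0)).HasSeparatingInvariant (fun z : ℤ => (z : K))
      (boundedConvexPolyhedra K n) := by
  obtain ⟨M, hM⟩ : ∃ M : ℕ, ∀ j ≤ N, ∀ k ≤ N, ∀ i, |X j i - X k i| ≤ M := by
    refine ⟨∑ j ∈ Finset.range (N + 1), ∑ k ∈ Finset.range (N + 1), ∑ i, (X j i - X k i).natAbs,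
      fun j hj k hk i => ?_⟩
    rw [Int.abs_eq_natAbs]
    norm_cast
    refine le_trans ?_ (Finset.single_le_sum (fun _ _ => Nat.zero_le _)
      (Finset.mem_range_succ_iff.2 hj))
    refine le_trans ?_ (Finset.single_le_sum (fun _ _ => Nat.zero_le _)
      (Finset.mem_range_succ_iff.2 hk))
    exact Finset.single_le_sum (f := fun i => (X j i - X k i).natAbs) (fun _ _ => Nat.zero_le _)
      (Finset.mem_univ i)
  rw [System.hasSeparatingInvariant_iff]
  -- the label of control state `1`, which contains the projection of the run polyhedron
  let Q : Set (Fin n → K) := {x | x ∈ clockPolygon K t s N ∧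
    ∀ i ∈ Finset.univ.filter fun i => i ≠ t ∧ i ≠ s, x i = 0}
  have hQ : Q ∈ boundedConvexPolyhedra K n := by
    refine ⟨inter_mem (clockPolygon_mem t s N) (iInter_mem _
      (P := fun i => {x : Fin n → K | x i = 0}) fun i _ => ?_), N * N + N, ?_⟩
    · convert inter_mem (affine_mem (K := K) i i i 1 0 0 0) (affine_mem (K := K) i i i (-1) 0 0 0)
        using 1
      ext x
      simp [le_antisymm_iff]
    · rintro x ⟨⟨h0, h1, h2, h3, -⟩, hx⟩ i
      have hN : (0 : K) ≤ N := Nat.cast_nonneg N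
      have h3' : x s ≤ N * N := h3.trans (by gcongr)
      by_cases hit : i = t
      · subst hit
        rw [abs_of_nonneg h0]; nlinarith
      · by_cases his : i = s
        · subst his
          rw [abs_of_nonneg h2]; nlinarith
        · rw [hx i (by simp [hit, his]), abs_zero]; positivity
  refine ⟨fun c => if c = 0 then runPolyhedron K t s N M X else if c = 1 then Q else ∅,
    fun c => ?_, ?_, by simp [clockSystem], ?_⟩
  · dsimp only
    split_ifs
    · exact ⟨runPolyhedron_mem t s N M X, runPolyhedron_bounded t s N M X⟩
    · exact hQ
    · exact ⟨empty_mem, 0, by simp⟩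
  · simpa [clockSystem] using mem_runPolyhedron (K := K) ht hs hM (Nat.zero_le N)
  · intro e he x x' hx hr
    simp only [clockSystem, List.mem_append, List.mem_cons, List.not_mem_nil, or_false] at he
    rcases he with he | rfl | rfl
    · obtain ⟨h0, h1, hg⟩ := hE e he
      simp only [h0, h1, if_true] at hx ⊢
      have hp := hr.1 _ hg
      simp only [Cmp.holds, eval_parabola, sub_eq_zero] at hp
      obtain ⟨j, hj, rfl⟩ := eq_of_mem_runPolyhedron hx hp
      obtain ⟨y, hy, rfl⟩ := (Edge.rel_intCast e _ _).1 hr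
      rcases hj.lt_or_eq with hlt | rfl
      · rw [hstep j hlt e he y hy]
        exact mem_runPolyhedron ht hs hM hlt
      · exact absurd hy (hlast e he y)
    · rw [projectEdge_rel] at hr
      simp only [projectEdge, if_true] at hx
      simp only [projectEdge, one_ne_zero, if_true, if_false]
      subst hr
      refine ⟨?_, fun i hi => ?_⟩
      · have := hx.1
        simpa [clockPolygon, hts.symm] using this
      · simp at hi
        simp [hi]
    · rw [badEdge_rel] at hr
      simp only [badEdge, one_ne_zero, if_true, if_false] at hx
      obtain ⟨⟨-, -, -, h4, -⟩, -⟩ := hx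
      rw [hr.1, hr.2.1, mul_zero] at h4
      exact absurd h4 (not_le.2 one_pos)

end Clock

open Turing Function

/-! ### A machine on registers simulating a stack machine -/

/-- Program points: a statement of the stack machine still to be executed (`none` once the machine
has halted), and the value of its local variable. -/
abbrev ProgPoint : Type :=
  Option (TM2.Stmt (fun _ : PartrecToTM2.K' => PartrecToTM2.Γ') PartrecToTM2.Λ'
    (Option PartrecToTM2.Γ')) × Option PartrecToTM2.Γ'

/-- Configurations of the register machine: the program point, a register for each stack, and a
work register. -/
structure Conf where
  pc : ProgPoint
  stk : PartrecToTM2.K' → ℕ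
  work : ℕ

/-- The base-`5` digit of the top of a stack; the empty stack has digit `0`. -/
def digit : Option PartrecToTM2.Γ' → ℕ
  | none => 0
  | some .consₗ => 1
  | some .cons => 2
  | some .bit0 => 3
  | some .bit1 => 4

/-- The inverse of `digit`. -/
def undigit : ℕ → Option PartrecToTM2.Γ'
  | 1 => some .consₗ
  | 2 => some .cons
  | 3 => some .bit0
  | 4 => some .bit1
  | _ => none

theorem digit_lt (o : Option PartrecToTM2.Γ') : digit o < 5 := by
  rcases o with _ | _ | _ | _ | _ <;> decide

theorem undigit_digit (o : Option PartrecToTM2.Γ') : undigit (digit o) = o := by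
  rcases o with _ | _ | _ | _ | _ <;> rfl

/-- A stack as a number in base `5`, the top being the lowest digit. -/
def stackNum : List PartrecToTM2.Γ' → ℕ
  | [] => 0
  | a :: l => 5 * stackNum l + digit (some a)

theorem stackNum_mod (l : List PartrecToTM2.Γ') : stackNum l % 5 = digit l.head? := by
  cases l with
  | nil => rfl
  | cons a l =>
    have := digit_lt (some a)
    simp only [stackNum, List.head?_cons]
    omega

theorem stackNum_div (l : List PartrecToTM2.Γ') : stackNum l / 5 = stackNum l.tail := by
  cases l with
  | nil => rfl
  | cons a l =>
    have := digit_lt (some a)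
    simp only [stackNum, List.tail_cons]
    omega

/-- One step of the register machine. Reading a stack divides its register by `5` with repeated
subtraction: the quotient is accumulated in the work register until the digit is left. -/
def regStep : Conf → Option Conf
  | ⟨(none, _), _, _⟩ => none
  | ⟨(some (.push k f q), v), S, w⟩ =>
    some ⟨(some q, v), update S k (5 * S k + digit (some (f v))), w⟩
  | ⟨(some (.peek k f q), v), S, w⟩ =>
    if S k < 5 then some ⟨(some q, f v (undigit (S k))), update S k (5 * w + S k), 0⟩
    else some ⟨(some (.peek k f q), v), update S k (S k - 5), w + 1⟩
  | ⟨(some (.pop k f q), v), S, w⟩ =>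
    if S k < 5 then some ⟨(some q, f v (undigit (S k))), update S k w, 0⟩
    else some ⟨(some (.pop k f q), v), update S k (S k - 5), w + 1⟩
  | ⟨(some (.load a q), v), S, w⟩ => some ⟨(some q, a v), S, w⟩
  | ⟨(some (.branch p q₁ q₂), v), S, w⟩ => some ⟨(some (cond (p v) q₁ q₂), v), S, w⟩
  | ⟨(some (.goto l), v), S, w⟩ => some ⟨(some (PartrecToTM2.tr (l v)), v), S, w⟩
  | ⟨(some .halt, v), S, w⟩ => some ⟨(none, v), S, w⟩

open StateTransition

theorem regStep_peek_reaches (k : PartrecToTM2.K') (f q v) (S : PartrecToTM2.K' → ℕ) (m w : ℕ)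
    (hm : S k = m) :
    Reaches₁ regStep ⟨(some (.peek k f q), v), S, w⟩
      ⟨(some q, f v (undigit (m % 5))), update S k (5 * w + m), 0⟩ := by
  induction m using Nat.strong_induction_on generalizing S w with
  | _ m ih =>
    rcases lt_or_ge m 5 with h | h
    · refine Relation.TransGen.single ?_
      simp [regStep, hm, h, Nat.mod_eq_of_lt h]
    · have h' : ¬ m < 5 := by omega
      have := ih (m - 5) (by omega) (update S k (m - 5)) (w + 1) (by simp)
      rw [update_idem, show 5 * (w + 1) + (m - 5) = 5 * w + m by omega,
        show (m - 5) % 5 = m % 5 by omega] at this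
      refine Relation.TransGen.head ?_ this
      simp [regStep, hm, h']

theorem regStep_pop_reaches (k : PartrecToTM2.K') (f q v) (S : PartrecToTM2.K' → ℕ) (m w : ℕ)
    (hm : S k = m) :
    Reaches₁ regStep ⟨(some (.pop k f q), v), S, w⟩
      ⟨(some q, f v (undigit (m % 5))), update S k (w + m / 5), 0⟩ := by
  induction m using Nat.strong_induction_on generalizing S w with
  | _ m ih =>
    rcases lt_or_ge m 5 with h | h
    · refine Relation.TransGen.single ?_
      simp [regStep, hm, h, Nat.mod_eq_of_lt h, Nat.div_eq_of_lt h]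
    · have h' : ¬ m < 5 := by omega
      have := ih (m - 5) (by omega) (update S k (m - 5)) (w + 1) (by simp)
      rw [update_idem, show w + 1 + (m - 5) / 5 = w + m / 5 by omega,
        show (m - 5) % 5 = m % 5 by omega] at this
      refine Relation.TransGen.head ?_ this
      simp [regStep, hm, h']

/-- The configuration of the register machine that corresponds to a configuration of the stack
machine. -/
def confOf (c : PartrecToTM2.Cfg') : Conf :=
  ⟨(c.l.map PartrecToTM2.tr, c.var), fun k => stackNum (c.stk k), 0⟩

theorem stackNum_update (S : PartrecToTM2.K' → List PartrecToTM2.Γ') (k : PartrecToTM2.K') (l) :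
    (fun k' => stackNum (update S k l k')) = update (fun k' => stackNum (S k')) k (stackNum l) := by
  ext k'
  by_cases h : k' = k
  · subst h; simp
  · simp [h]

theorem regStep_stepAux (q) (v : Option PartrecToTM2.Γ')
    (S : PartrecToTM2.K' → List PartrecToTM2.Γ') :
    Reaches₁ regStep ⟨(some q, v), fun k => stackNum (S k), 0⟩ (confOf (TM2.stepAux q v S)) := by
  induction q generalizing v S with
  | push k f q ih =>
    refine Relation.TransGen.head ?_ (ih v _)
    simp [regStep, stackNum_update, stackNum]
  | peek k f q ih =>
    have := regStep_peek_reaches k f q v (fun k => stackNum (S k)) _ 0 rfl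
    rw [stackNum_mod, undigit_digit, mul_zero, zero_add, update_eq_self] at this
    exact this.trans (ih _ _)
  | pop k f q ih =>
    have := regStep_pop_reaches k f q v (fun k => stackNum (S k)) _ 0 rfl
    rw [stackNum_mod, undigit_digit, zero_add, stackNum_div, ← stackNum_update] at this
    exact this.trans (ih _ _)
  | load a q ih => exact Relation.TransGen.head (by simp [regStep]) (ih _ _)
  | branch p q₁ q₂ ih₁ ih₂ =>
    refine Relation.TransGen.head
      (b := ⟨(some (cond (p v) q₁ q₂), v), fun k => stackNum (S k), 0⟩) rfl ?_
    rw [TM2.stepAux]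
    cases p v
    · exact ih₂ v S
    · exact ih₁ v S
  | goto l => exact Relation.TransGen.single rfl
  | halt => exact Relation.TransGen.single rfl

theorem regStep_respects :
    Respects (TM2.step PartrecToTM2.tr) regStep fun c a => a = confOf c := by
  rintro ⟨_ | l, v, S⟩ a rfl
  · rfl
  · exact ⟨_, rfl, regStep_stepAux _ _ _⟩

/-- The initial configuration for the code `c` on the one-element input `[m]`. -/
def initConf (c : ToPartrec.Code) (m : ℕ) : Conf := confOf (PartrecToTM2.init c [m])

theorem eval_regStep_dom (c : ToPartrec.Code) (m : ℕ) :
    (eval regStep (initConf c m)).Dom ↔ (c.eval [m]).Dom := by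
  refine (tr_eval_dom (f₁ := TM2.step PartrecToTM2.tr) (a₁ := PartrecToTM2.init c [m])
    regStep_respects rfl).trans ?_
  have h := congrArg Part.Dom (PartrecToTM2.tr_eval c [m])
  exact iff_of_eq h

/-- The run of a partial step function, which stays where it is once no step is possible. -/
def run {α : Type} (f : α → Option α) (a : α) : ℕ → α
  | 0 => a
  | j + 1 => (f (run f a j)).getD (run f a j)

theorem run_succ {α : Type} {f : α → Option α} {a b : α} {j : ℕ} (h : f (run f a j) = some b) :
    run f a (j + 1) = b := by
  rw [run, h]
  rfl

theorem eval_dom_iff_run {α : Type} (f : α → Option α) (a : α) :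
    (eval f a).Dom ↔ ∃ N, f (run f a N) = none := by
  rw [Part.dom_iff_mem]
  simp only [mem_eval]
  constructor
  · rintro ⟨b, hab, hb⟩
    suffices ∃ N, run f a N = b by obtain ⟨N, rfl⟩ := this; exact ⟨N, hb⟩
    clear hb
    induction hab with
    | refl => exact ⟨0, rfl⟩
    | tail _ h ih =>
      obtain ⟨N, rfl⟩ := ih
      exact ⟨N + 1, run_succ h⟩
  · rintro ⟨N, hN⟩
    refine ⟨run f a N, ?_, hN⟩
    clear hN
    induction N with
    | zero => exact .refl
    | succ N ih =>
      rw [run]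
      cases h : f (run f a N) with
      | none => exact ih
      | some b => exact ih.tail h

/-! ### Finitely many program points -/

/-- The program points that occur in runs of the code `c`. -/
noncomputable def progPoints (c : ToPartrec.Code) : Finset ProgPoint :=
  TM2.stmts PartrecToTM2.tr (PartrecToTM2.codeSupp c .halt) ×ˢ Finset.univ

theorem some_mem_stmts {K Λ σ : Type} {Γ : K → Type} {M : Λ → TM2.Stmt Γ Λ σ} {S : Finset Λ}
    {l : Λ} (h : l ∈ S) : some (M l) ∈ TM2.stmts M S := by
  simp only [TM2.stmts, Finset.some_mem_insertNone, Finset.mem_biUnion]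
  exact ⟨l, h, TM2.stmts₁_self⟩

theorem initConf_pc_mem (c : ToPartrec.Code) (m : ℕ) : (initConf c m).pc ∈ progPoints c := by
  exact Finset.mem_product.2
    ⟨some_mem_stmts (PartrecToTM2.tr_supports c .halt).1, Finset.mem_univ _⟩

theorem regStep_pc_mem (c : ToPartrec.Code) {a b : Conf} (ha : a.pc ∈ progPoints c)
    (h : regStep a = some b) : b.pc ∈ progPoints c := by
  have hs := PartrecToTM2.tr_supports c .halt
  simp only [progPoints, Finset.mem_product, Finset.mem_univ, and_true] at ha ⊢
  obtain ⟨⟨_ | q, v⟩, S, w⟩ := a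
  · simp [regStep] at h
  have sub : ∀ q', q' ∈ TM2.stmts₁ q → some q' ∈
      TM2.stmts PartrecToTM2.tr (PartrecToTM2.codeSupp c .halt) :=
    fun q' hq' => TM2.stmts_trans hq' ha
  cases q with
  | push k f q =>
    simp only [regStep, Option.some.injEq] at h
    subst h
    exact sub _ (by simp [TM2.stmts₁, TM2.stmts₁_self])
  | peek k f q =>
    simp only [regStep] at h
    split_ifs at h <;> simp only [Option.some.injEq] at h <;> subst h
    · exact sub _ (by simp [TM2.stmts₁, TM2.stmts₁_self])
    · exact ha
  | pop k f q =>
    simp only [regStep] at h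
    split_ifs at h <;> simp only [Option.some.injEq] at h <;> subst h
    · exact sub _ (by simp [TM2.stmts₁, TM2.stmts₁_self])
    · exact ha
  | load a q =>
    simp only [regStep, Option.some.injEq] at h
    subst h
    exact sub _ (by simp [TM2.stmts₁, TM2.stmts₁_self])
  | branch p q₁ q₂ =>
    simp only [regStep, Option.some.injEq] at h
    subst h
    refine sub _ ?_
    cases p v <;> simp [TM2.stmts₁, TM2.stmts₁_self]
  | goto l =>
    simp only [regStep, Option.some.injEq] at h
    subst h
    have hl : ∀ v, l v ∈ PartrecToTM2.codeSupp c .halt :=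
      @TM2.stmts_supportsStmt _ _ _ _ ⟨_⟩ _ _ _ hs ha
    exact some_mem_stmts (hl v)
  | halt =>
    simp only [regStep, Option.some.injEq] at h
    subst h
    simp [TM2.stmts]

/-! ### Affine instructions -/

/-- Affine forms `∑ a * x i + b` in variables indexed by natural numbers. -/
abbrev AffForm : Type := List (ℤ × ℕ) × ℤ

/-- The value of an affine form. -/
def AffForm.val (A : AffForm) (x : ℕ → ℤ) : ℤ := (A.1.map fun m => m.1 * x m.2).sum + A.2

/-- An affine form as a polynomial in `n` variables, the variables of index at least `n` being
read as `1`. -/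
def AffForm.toPoly (n : ℕ) (A : AffForm) : Poly ℤ n :=
  (A.2, 0) :: A.1.map fun m => (m.1, fun j => if j.1 = m.2 then 1 else 0)

/-- The coefficient of the variable `j`. -/
def AffForm.coeff (A : AffForm) (j : ℕ) : ℤ := (A.1.map fun m => if m.2 = j then m.1 else 0).sum

theorem AffForm.sum_coeff {n : ℕ} (A : AffForm) (x : ℕ → ℤ) (hx : ∀ i, n ≤ i → x i = 0) :
    ∑ j : Fin n, A.coeff j * x j + A.2 = A.val x := by
  obtain ⟨L, b⟩ := A
  simp only [coeff, val, add_left_inj]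
  induction L with
  | nil => simp
  | cons m L ih =>
    simp only [List.map_cons, List.sum_cons, add_mul, Finset.sum_add_distrib, ih, add_left_inj]
    rcases lt_or_ge m.2 n with h | h
    · rw [Finset.sum_eq_single ⟨m.2, h⟩]
      · simp
      · intro j _ hj
        rw [if_neg, zero_mul]
        rintro h'
        exact hj (Fin.ext h'.symm)
      · simp
    · rw [hx _ h, mul_zero]
      refine Finset.sum_eq_zero fun j _ => ?_
      rw [if_neg (by omega), zero_mul]

theorem AffForm.eval_toPoly {n : ℕ} (A : AffForm) (x : ℕ → ℤ) (hA : ∀ m ∈ A.1, m.2 < n) :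
    (A.toPoly n).eval (fun z => z) (fun i : Fin n => x i) = A.val x := by
  obtain ⟨L, b⟩ := A
  simp only [toPoly, val, Poly.eval, List.map_cons, List.sum_cons, List.map_map]
  rw [add_comm]
  congr 2
  · refine List.map_congr_left fun m hm => ?_
    have := hA m hm
    simp only [comp_apply]
    rw [Finset.prod_eq_single ⟨m.2, this⟩]
    · simp
    · intro j _ hj
      rw [if_neg, pow_zero]
      rintro h'
      exact hj (Fin.ext h')
    · simp
  · simp

/-- A guarded affine update of the registers with a jump. -/
structure Instr where
  tgt : ProgPoint
  guards : List (Cmp × AffForm)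
  upd : ℕ → AffForm

/-- The update that keeps the registers `0, …, 7` (and clears the others). -/
def keep (i : ℕ) : AffForm := if i < 8 then ([(1, i)], 0) else ([], 0)

/-- The register of a stack. Registers `0`, `1`, `2`, `3` are the clock, its square, the program
point, and the work register. -/
def reg : PartrecToTM2.K' → ℕ
  | .main => 4
  | .rev => 5
  | .aux => 6
  | .stack => 7

/-- The instruction that subtracts `5` from the register of a stack. -/
def subInstr (pc : ProgPoint) (k : PartrecToTM2.K') : Instr :=
  ⟨pc, [(.le, ([(-1, reg k)], 5))],
    update (update keep (reg k) ([(1, reg k)], -5)) 3 ([(1, 3)], 1)⟩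

/-- The instructions of the register machine at a program point. -/
def instrs : ProgPoint → List Instr
  | (none, _) => []
  | (some (.push k f q), v) =>
    [⟨(some q, v), [], update keep (reg k) ([(5, reg k)], digit (some (f v)))⟩]
  | (some (.peek k f q), v) =>
    subInstr (some (.peek k f q), v) k :: (List.range 5).map fun d =>
      ⟨(some q, f v (undigit d)), [(.eq, ([(1, reg k)], -d))],
        update (update keep (reg k) ([(5, 3)], d)) 3 ([], 0)⟩
  | (some (.pop k f q), v) =>
    subInstr (some (.pop k f q), v) k :: (List.range 5).map fun d =>
      ⟨(some q, f v (undigit d)), [(.eq, ([(1, reg k)], -d))],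
        update (update keep (reg k) ([(1, 3)], 0)) 3 ([], 0)⟩
  | (some (.load a q), v) => [⟨(some q, a v), [], keep⟩]
  | (some (.branch p q₁ q₂), v) => [⟨(some (cond (p v) q₁ q₂), v), [], keep⟩]
  | (some (.goto l), v) => [⟨(some (PartrecToTM2.tr (l v)), v), [], keep⟩]
  | (some .halt, v) => [⟨(none, v), [], keep⟩]

/-- The registers at time `j`; program points are numbered by `idx`. -/
def regs (idx : ProgPoint → ℕ) (j : ℕ) (a : Conf) : ℕ → ℤ
  | 0 => j
  | 1 => (j : ℤ) ^ 2
  | 2 => idx a.pc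
  | 3 => a.work
  | 4 => a.stk .main
  | 5 => a.stk .rev
  | 6 => a.stk .aux
  | 7 => a.stk .stack
  | _ => 0

theorem regs_reg (idx : ProgPoint → ℕ) (j : ℕ) (a : Conf) (k : PartrecToTM2.K') :
    regs idx j a (reg k) = a.stk k := by
  cases k <;> rfl

theorem regs_eq_zero (idx : ProgPoint → ℕ) (j : ℕ) (a : Conf) {i : ℕ} (hi : 8 ≤ i) :
    regs idx j a i = 0 := by
  obtain ⟨i, rfl⟩ := Nat.exists_eq_add_of_le' hi
  rfl

theorem val_keep (idx : ProgPoint → ℕ) (j : ℕ) (a : Conf) (i : ℕ) :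
    (keep i).val (regs idx j a) = regs idx j a i := by
  unfold keep
  split_ifs with h
  · simp [AffForm.val]
  · rw [regs_eq_zero _ _ _ (by omega)]; rfl

/-- Replacing the forms of the register of `k` and of the work register changes just these two
registers of the configuration. -/
theorem val_update_keep (idx : ProgPoint → ℕ) (j : ℕ) (a : Conf) (pc : ProgPoint)
    (k : PartrecToTM2.K') (A B : AffForm) (x w : ℕ) (hA : A.val (regs idx j a) = x)
    (hB : B.val (regs idx j a) = w) (i : ℕ) (hi : 3 ≤ i) :
    (update (update keep (reg k) A) 3 B i).val (regs idx j a) =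
      regs idx (j + 1) ⟨pc, update a.stk k x, w⟩ i := by
  by_cases h3 : i = 3
  · subst h3; simpa [regs] using hB
  rw [update_of_ne h3]
  by_cases hk : i = reg k
  · subst hk; rw [update_self, regs_reg, hA]; simp
  rw [update_of_ne hk, val_keep]
  rcases lt_or_ge i 8 with h8 | h8
  · cases k <;> interval_cases i <;> simp_all [reg, regs]
  · rw [regs_eq_zero _ _ _ h8, regs_eq_zero _ _ _ h8]

theorem val_keep' (idx : ProgPoint → ℕ) (j : ℕ) (a : Conf) (pc : ProgPoint) (i : ℕ) (hi : 3 ≤ i) :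
    (keep i).val (regs idx j a) = regs idx (j + 1) ⟨pc, a.stk, a.work⟩ i := by
  rw [val_keep]
  rcases lt_or_ge i 8 with h8 | h8
  · interval_cases i <;> rfl
  · rw [regs_eq_zero _ _ _ h8, regs_eq_zero _ _ _ h8]

/-- The guards of an instruction at the given registers. -/
def Instr.Enabled (I : Instr) (x : ℕ → ℤ) : Prop := ∀ g ∈ I.guards, g.1.holds (g.2.val x)

theorem update_keep_three (A : ℕ → AffForm) (h : A 3 = ([(1, 3)], 0)) :
    update A 3 ([(1, 3)], 0) = A := by
  rw [← h, update_eq_self]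

theorem regStep_of_enabled (idx : ProgPoint → ℕ) (j : ℕ) (a : Conf) (I : Instr)
    (hI : I ∈ instrs a.pc) (hg : I.Enabled (regs idx j a)) :
    ∃ b, regStep a = some b ∧ b.pc = I.tgt ∧
      ∀ i, 3 ≤ i → (I.upd i).val (regs idx j a) = regs idx (j + 1) b i := by
  obtain ⟨⟨_ | q, v⟩, S, w⟩ := a
  · simp [instrs] at hI
  have hsub : ∀ pc k, (subInstr pc k).Enabled (regs idx j ⟨(some q, v), S, w⟩) → ¬ S k < 5 ∧
      ∀ i, 3 ≤ i → ((subInstr pc k).upd i).val (regs idx j ⟨(some q, v), S, w⟩) =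
        regs idx (j + 1) ⟨pc, update S k (S k - 5), w + 1⟩ i := by
    intro pc k h
    have h5 : 5 ≤ S k := by
      have := h _ (List.mem_singleton_self _)
      simp [AffForm.val, Cmp.holds, regs_reg] at this
      omega
    refine ⟨by omega, fun i hi => ?_⟩
    refine val_update_keep idx j _ _ k _ _ _ _ ?_ ?_ i hi
    · simp [AffForm.val, regs_reg]; omega
    · simp [AffForm.val, regs]
  cases q with
  | push k f q =>
    simp only [instrs, List.mem_singleton] at hI
    subst hI
    refine ⟨_, rfl, rfl, fun i hi => ?_⟩
    have h3 : update keep (reg k) ([(5, reg k)], (digit (some (f v)) : ℤ)) 3 = ([(1, 3)], 0) := by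
      cases k <;> rfl
    rw [← update_keep_three _ h3]
    refine val_update_keep idx j _ _ k _ _ _ _ ?_ ?_ i hi
    · simp [AffForm.val, regs_reg]
    · simp [AffForm.val, regs]
  | peek k f q =>
    simp only [instrs, List.mem_cons, List.mem_map, List.mem_range] at hI
    rcases hI with rfl | ⟨d, hd, rfl⟩
    · obtain ⟨h5, h⟩ := hsub _ _ hg
      exact ⟨_, by simp [regStep, h5], rfl, h⟩
    · have hSd : S k = d := by
        have := hg _ (List.mem_singleton_self _)
        simp [AffForm.val, Cmp.holds, regs_reg] at this
        omega
      refine ⟨_, by simp [regStep, hSd, hd]; rfl, rfl, fun i hi => ?_⟩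
      refine val_update_keep idx j _ _ k _ _ _ _ ?_ ?_ i hi <;> simp [AffForm.val, regs]
  | pop k f q =>
    simp only [instrs, List.mem_cons, List.mem_map, List.mem_range] at hI
    rcases hI with rfl | ⟨d, hd, rfl⟩
    · obtain ⟨h5, h⟩ := hsub _ _ hg
      exact ⟨_, by simp [regStep, h5], rfl, h⟩
    · have hSd : S k = d := by
        have := hg _ (List.mem_singleton_self _)
        simp [AffForm.val, Cmp.holds, regs_reg] at this
        omega
      refine ⟨_, by simp [regStep, hSd, hd]; rfl, rfl, fun i hi => ?_⟩
      refine val_update_keep idx j _ _ k _ _ _ _ ?_ ?_ i hi <;> simp [AffForm.val, regs]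
  | load a q | branch p q₁ q₂ | goto l | halt =>
    simp only [instrs, List.mem_singleton] at hI
    subst hI
    exact ⟨_, rfl, rfl, val_keep' idx j _ _⟩

theorem exists_enabled (idx : ProgPoint → ℕ) (j : ℕ) {a b : Conf} (h : regStep a = some b) :
    ∃ I ∈ instrs a.pc, I.Enabled (regs idx j a) := by
  obtain ⟨⟨_ | q, v⟩, S, w⟩ := a
  · simp [regStep] at h
  cases q with
  | peek k f q | pop k f q =>
    by_cases h5 : S k < 5
    · refine ⟨_, List.mem_cons_of_mem _ (List.mem_map_of_mem (List.mem_range.2 h5)), ?_⟩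
      simp [Instr.Enabled, AffForm.val, Cmp.holds, regs_reg]
    · refine ⟨_, List.mem_cons_self, ?_⟩
      simp [subInstr, Instr.Enabled, AffForm.val, Cmp.holds, regs_reg]
      omega
  | push k f q | load a q | branch p q₁ q₂ | goto l | halt =>
    exact ⟨_, List.mem_singleton_self _, by simp [Instr.Enabled]⟩

theorem guard_index_lt {pc : ProgPoint} {I : Instr} (hI : I ∈ instrs pc) :
    ∀ g ∈ I.guards, ∀ m ∈ g.2.1, m.2 < 8 := by
  obtain ⟨_ | q, v⟩ := pc
  · simp [instrs] at hI
  have hreg : ∀ k, reg k < 8 := by intro k; cases k <;> decide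
  cases q with
  | peek k f q | pop k f q =>
    simp only [instrs, List.mem_cons, List.mem_map, List.mem_range] at hI
    rcases hI with rfl | ⟨d, hd, rfl⟩ <;> simp [subInstr, hreg]
  | push k f q | load a q | branch p q₁ q₂ | goto l | halt =>
    simp only [instrs, List.mem_singleton] at hI
    subst hI
    simp

/-! ### The edges of the register machine -/

/-- The update of all coordinates: the clock advances, its square follows by
`(t + 1) ^ 2 = s + 2 t + 1`, and the program point becomes `p`. -/
def clockUpd (p : ℤ) (u : ℕ → AffForm) : ℕ → AffForm
  | 0 => ([(1, 0)], 1)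
  | 1 => ([(2, 0), (1, 1)], 1)
  | 2 => ([], p)
  | i + 3 => u (i + 3)

/-- The edge of the instruction `I` at the program point `pc`. -/
def instrEdge {n : ℕ} (hn : 8 ≤ n) (idx : ProgPoint → ℕ) (pc : ProgPoint) (I : Instr) :
    Edge ℤ n where
  src := 0
  tgt := 0
  guard := (.eq, parabola ⟨0, by omega⟩ ⟨1, by omega⟩) ::
    (.eq, AffForm.toPoly n ([(1, 2)], -idx pc)) :: I.guards.map fun g => (g.1, g.2.toPoly n)
  mat i j := (clockUpd (idx I.tgt) I.upd i).coeff j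
  vec i := (clockUpd (idx I.tgt) I.upd i).2

theorem instrEdge_rel {n : ℕ} (hn : 8 ≤ n) (idx : ProgPoint → ℕ) (pc : ProgPoint) {I : Instr}
    (hI : I ∈ instrs pc) (j : ℕ) (a : Conf) (y : Fin n → ℤ) :
    (instrEdge hn idx pc I).rel (fun z => z) (fun i => regs idx j a i) y ↔
      (idx a.pc = idx pc ∧ I.Enabled (regs idx j a)) ∧
        y = fun i : Fin n => (clockUpd (idx I.tgt) I.upd i).val (regs idx j a) := by
  have hpar := eval_parabola (K := ℤ) (⟨0, by omega⟩ : Fin n) ⟨1, by omega⟩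
    (fun i => regs idx j a i)
  have hpc := AffForm.eval_toPoly (n := n) ([(1, 2)], -(idx pc : ℤ)) (regs idx j a)
    (by simp; omega)
  simp only [Int.cast_id] at hpar
  simp only [Edge.rel, instrEdge, List.forall_mem_cons, List.forall_mem_map, hpar, hpc,
    AffForm.sum_coeff _ _ fun i hi => regs_eq_zero idx j a (hn.trans hi), funext_iff]
  refine and_congr ?_ Iff.rfl
  have h1 : Cmp.eq.holds (regs idx j a 1 - regs idx j a 0 ^ 2) := by
    simp [Cmp.holds, regs]
  have h2 : Cmp.eq.holds (AffForm.val ([(1, 2)], -(idx pc : ℤ)) (regs idx j a)) ↔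
      idx a.pc = idx pc := by
    simp [Cmp.holds, regs, AffForm.val, add_neg_eq_zero]
  simp only [h1, true_and, h2, Instr.Enabled]
  refine and_congr_right fun _ => forall₂_congr fun g hg => ?_
  rw [AffForm.eval_toPoly _ _ fun m hm => (guard_index_lt hI g hg m hm).trans_le hn]

theorem clockUpd_val (idx : ProgPoint → ℕ) (j : ℕ) (a b : Conf) {I : Instr} (hb : b.pc = I.tgt)
    (h : ∀ i, 3 ≤ i → (I.upd i).val (regs idx j a) = regs idx (j + 1) b i) (i : ℕ) :
    (clockUpd (idx I.tgt) I.upd i).val (regs idx j a) = regs idx (j + 1) b i := by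
  match i with
  | 0 => simp [clockUpd, AffForm.val, regs]
  | 1 => simp [clockUpd, AffForm.val, regs]; ring
  | 2 => simp [clockUpd, AffForm.val, regs, hb]
  | i + 3 => exact h _ (by omega)

open scoped Classical in
/-- A numbering of the program points that is injective on `progPoints c`. -/
noncomputable def pointIndex (c : ToPartrec.Code) (pc : ProgPoint) : ℕ :=
  (progPoints c).toList.idxOf pc

theorem pointIndex_inj {c : ToPartrec.Code} {p q : ProgPoint} (hp : p ∈ progPoints c)
    (h : pointIndex c p = pointIndex c q) : p = q := by
  classical
  exact (List.idxOf_inj (by simpa using hp)).1 h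

/-- All edges of the register machine for the code `c`. -/
noncomputable def machineEdges {n : ℕ} (hn : 8 ≤ n) (c : ToPartrec.Code) : List (Edge ℤ n) :=
  (progPoints c).toList.flatMap fun pc => (instrs pc).map (instrEdge hn (pointIndex c) pc)

theorem machineEdges_rel {n : ℕ} (hn : 8 ≤ n) {c : ToPartrec.Code} (j : ℕ) {a : Conf}
    {e : Edge ℤ n} (he : e ∈ machineEdges hn c) {y : Fin n → ℤ}
    (hr : e.rel (fun z => z) (fun i => regs (pointIndex c) j a i) y) :
    ∃ b, regStep a = some b ∧ y = fun i : Fin n => regs (pointIndex c) (j + 1) b i := by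
  simp only [machineEdges, List.mem_flatMap, List.mem_map, Finset.mem_toList] at he
  obtain ⟨pc, hpc, I, hI, rfl⟩ := he
  rw [instrEdge_rel hn _ _ hI] at hr
  obtain ⟨⟨hidx, hen⟩, rfl⟩ := hr
  obtain rfl := pointIndex_inj hpc hidx.symm
  obtain ⟨b, hb, hbt, hu⟩ := regStep_of_enabled _ j a I hI hen
  exact ⟨b, hb, funext fun i => clockUpd_val _ j a b hbt hu i⟩

theorem exists_machineEdges_rel {n : ℕ} (hn : 8 ≤ n) {c : ToPartrec.Code} (j : ℕ) {a b : Conf}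
    (ha : a.pc ∈ progPoints c) (h : regStep a = some b) :
    ∃ e ∈ machineEdges hn c, e.rel (fun z => z) (fun i => regs (pointIndex c) j a i)
      (fun i => regs (pointIndex c) (j + 1) b i) := by
  obtain ⟨I, hI, hen⟩ := exists_enabled (pointIndex c) j h
  obtain ⟨b', hb, hbt, hu⟩ := regStep_of_enabled _ j a I hI hen
  obtain rfl : b' = b := by rw [h] at hb; exact (Option.some.inj hb).symm
  refine ⟨instrEdge hn (pointIndex c) a.pc I, ?_, ?_⟩
  · simp only [machineEdges, List.mem_flatMap, List.mem_map, Finset.mem_toList]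
    exact ⟨_, ha, I, hI, rfl⟩
  · rw [instrEdge_rel hn _ _ hI]
    exact ⟨⟨rfl, hen⟩, funext fun i => (clockUpd_val _ j a b' hbt hu i).symm⟩

/-! ### Invariants exist exactly for halting computations -/

/-- The coordinates at time `j` of the run of the code `c` on input `[m]`. -/
noncomputable def orbit (n : ℕ) (c : ToPartrec.Code) (m j : ℕ) (i : Fin n) : ℤ :=
  regs (pointIndex c) j (run regStep (initConf c m) j) i

/-- The system that simulates the code `c` on input `[m]`. -/
noncomputable def machineSystem {n : ℕ} (hn : 8 ≤ n) (c : ToPartrec.Code) (m : ℕ) : System ℤ n :=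
  clockSystem ⟨0, by omega⟩ ⟨1, by omega⟩ (machineEdges hn c) (orbit n c m 0)

section

variable {K : Type} [CommRing K] [LinearOrder K]

theorem System.HasSeparatingInvariant.mono {R : Type} {n : ℕ} {v : R → K}
    {D D' : Set (Set (Fin n → K))}
    (hD : D ⊆ D') {S : System R n} (h : S.HasSeparatingInvariant v D) :
    S.HasSeparatingInvariant v D' := by
  obtain ⟨I, hI⟩ := h
  exact ⟨I, fun c => hD (hI.mem_class c), hI.init_mem, hI.bad_empty, hI.stable⟩

variable [IsStrictOrderedRing K]

theorem machineSystem_bounded {n : ℕ} (hn : 8 ≤ n) (c : ToPartrec.Code) (m : ℕ)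
    (h : (c.eval [m]).Dom) :
    (machineSystem hn c m).HasSeparatingInvariant (fun z : ℤ => (z : K))
      (boundedConvexPolyhedra K n) := by
  classical
  rw [← eval_regStep_dom, eval_dom_iff_run] at h
  refine hasSeparatingInvariant_of_finite (by simp) (fun j => rfl) (fun j => rfl) ?_ (Nat.find h)
    ?_ ?_
  · intro e he
    simp only [machineEdges, List.mem_flatMap, List.mem_map] at he
    obtain ⟨pc, -, I, -, rfl⟩ := he
    exact ⟨rfl, rfl, List.mem_cons_self⟩
  · intro j hj e he y hr
    obtain ⟨b, hb, rfl⟩ := machineEdges_rel hn j he hr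
    funext i
    rw [orbit, run_succ hb]
  · intro e he y hr
    obtain ⟨b, hb, -⟩ := machineEdges_rel hn _ he hr
    rw [Nat.find_spec h] at hb
    exact absurd hb (by simp)

theorem dom_of_machineSystem [Archimedean K] {n : ℕ} (hn : 8 ≤ n) (c : ToPartrec.Code) (m : ℕ)
    (h : (machineSystem hn c m).HasSeparatingInvariant (fun z : ℤ => (z : K))
      (convexPolyhedra K n)) : (c.eval [m]).Dom := by
  by_contra hd
  rw [← eval_regStep_dom, eval_dom_iff_run] at hd
  push Not at hd
  refine not_hasSeparatingInvariant_of_infinite (K := K) (by simp) (fun j => rfl) (fun j => rfl)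
    ?_ ?_ h
  · intro e he
    simp only [machineEdges, List.mem_flatMap, List.mem_map] at he
    obtain ⟨pc, -, I, -, rfl⟩ := he
    exact ⟨rfl, rfl⟩
  · have hmem : ∀ j, (run regStep (initConf c m) j).pc ∈ progPoints c := by
      intro j
      induction j with
      | zero => exact initConf_pc_mem c m
      | succ j ih =>
        obtain ⟨b, hb⟩ := Option.ne_none_iff_exists'.1 (hd j)
        rw [run_succ hb]
        exact regStep_pc_mem c ih hb
    intro j
    obtain ⟨b, hb⟩ := Option.ne_none_iff_exists'.1 (hd j)
    obtain ⟨e, he, hr⟩ := exists_machineEdges_rel hn j (hmem j) hb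
    refine ⟨e, he, ?_⟩
    rw [← run_succ hb] at hr
    exact hr

/-- For every class between the bounded and all convex polyhedra, an invariant exists exactly if
the simulated computation halts. -/
theorem machineSystem_iff [Archimedean K] {n : ℕ} (hn : 8 ≤ n) (c : ToPartrec.Code) (m : ℕ)
    {D : Set (Set (Fin n → K))} (h₁ : boundedConvexPolyhedra K n ⊆ D)
    (h₂ : D ⊆ convexPolyhedra K n) :
    (machineSystem hn c m).HasSeparatingInvariant (fun z : ℤ => (z : K)) D ↔
      (c.eval [m]).Dom :=
  ⟨fun h => dom_of_machineSystem hn c m (System.HasSeparatingInvariant.mono h₂ h),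
    fun h => System.HasSeparatingInvariant.mono h₁ (machineSystem_bounded hn c m h)⟩

end

/-! ### The reduction is computable -/

/-- The number of the stack that holds `m` in binary, followed by a separator. -/
def inputNum (m : ℕ) : ℕ := stackNum (PartrecToTM2.trList [m])

theorem inputNum_zero : inputNum 0 = 2 := by
  simp [inputNum, PartrecToTM2.trList, stackNum, digit]

theorem inputNum_eq (m : ℕ) (hm : m ≠ 0) :
    inputNum m = 5 * inputNum (m / 2) + if m % 2 = 0 then 3 else 4 := by
  obtain ⟨k, rfl | rfl⟩ := Nat.even_or_odd' m
  · have h : ((2 * k : ℕ) : Num) = Num.bit0 k := by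
      rw [← Num.bit0_of_bit0, two_mul, Nat.cast_add]
    have h1 : 2 * k / 2 = k := by omega
    have h2 : 2 * k % 2 = 0 := by omega
    rw [h1, if_pos h2]
    have hk : (k : Num) ≠ 0 := by
      have : k ≠ 0 := by omega
      exact_mod_cast this
    simp only [inputNum, PartrecToTM2.trList, PartrecToTM2.trNat, h]
    cases hk' : (k : Num) with
    | zero => exact absurd hk' hk
    | pos p => rfl
  · have h : ((2 * k + 1 : ℕ) : Num) = Num.bit1 k := by
      rw [← Num.bit1_of_bit1, two_mul, Nat.cast_add, Nat.cast_add, Nat.cast_one]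
    have h1 : (2 * k + 1) / 2 = k := by omega
    have h2 : ¬ (2 * k + 1) % 2 = 0 := by omega
    rw [h1, if_neg h2]
    simp only [inputNum, PartrecToTM2.trList, PartrecToTM2.trNat, h]
    cases (k : Num) with
    | zero => rfl
    | pos p => rfl

theorem primrec_inputNum : Primrec inputNum := by
  have hg : Primrec₂ fun (_ : Unit) (l : List ℕ) => some (if l.length = 0 then 2 else
      5 * l.getD (l.length / 2) 0 + if l.length % 2 = 0 then 3 else 4) := by
    refine Primrec.option_some.comp (Primrec.ite ?_ (Primrec.const _) ?_)
    · exact Primrec.eq.comp (Primrec.list_length.comp Primrec.snd) (Primrec.const 0)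
    · refine Primrec.nat_add.comp (Primrec.nat_mul.comp (Primrec.const 5) ?_) (Primrec.ite ?_
        (Primrec.const _) (Primrec.const _))
      · exact (Primrec.list_getD 0).comp Primrec.snd
          (Primrec.nat_div.comp (Primrec.list_length.comp Primrec.snd) (Primrec.const 2))
      · exact Primrec.eq.comp
          (Primrec.nat_mod.comp (Primrec.list_length.comp Primrec.snd) (Primrec.const 2))
          (Primrec.const 0)
  have := Primrec.nat_strong_rec (fun (_ : Unit) m => inputNum m) hg (by
    intro _ m
    simp only [List.length_map, List.length_range, Option.some.injEq]
    split_ifs with h0 h1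
    · rw [h0, inputNum_zero]
    · rw [inputNum_eq m h0, if_pos h1]
      simp [show m / 2 < m by omega]
    · rw [inputNum_eq m h0, if_neg h1]
      simp [show m / 2 < m by omega])
  exact this.comp (Primrec.const ()) Primrec.id

theorem orbit_zero {n : ℕ} (c : ToPartrec.Code) (m : ℕ) (i : Fin n) :
    orbit n c m 0 i = if i.1 = 4 then (inputNum m : ℤ) else orbit n c 0 0 i := by
  split_ifs with h
  · rw [orbit, h]; rfl
  · rcases lt_or_ge i.1 8 with h8 | h8
    · simp only [orbit]
      generalize i.1 = k at h h8
      interval_cases k <;> first | rfl | exact absurd rfl h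
    · rw [orbit, orbit, regs_eq_zero _ _ _ h8, regs_eq_zero _ _ _ h8]

theorem primrec_machineSystem {R : Type} [Primcodable R] {ι : ℤ → R} (hι : Primrec ι) {n : ℕ}
    (hn : 8 ≤ n) (c : ToPartrec.Code) : Primrec fun m => (machineSystem hn c m).map ι := by
  have hint : Primrec fun m : ℕ => (m : ℤ) := by
    refine Primrec.encode_iff.1 ?_
    exact (Primrec.nat_mul.comp (Primrec.const 2) Primrec.id).of_eq fun m => rfl
  have hstart : Primrec fun m => fun i => ι (orbit n c m 0 i) := by
    refine (Primrec.fin_curry (f := fun m (i : Fin n) => ι (orbit n c m 0 i))).2 ?_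
    have : Primrec fun p : ℕ × Fin n =>
        if p.2.1 = 4 then ι (inputNum p.1) else ι (orbit n c 0 0 p.2) := by
      refine Primrec.ite ?_ ?_ ?_
      · exact Primrec.eq.comp (Primrec.fin_val.comp Primrec.snd) (Primrec.const 4)
      · exact hι.comp (hint.comp (primrec_inputNum.comp Primrec.fst))
      · exact (Primrec.dom_finite fun i : Fin n => ι (orbit n c 0 0 i)).comp Primrec.snd
    refine this.of_eq fun p => ?_
    simp only [orbit_zero c p.1 p.2]
    split_ifs <;> rfl
  have h : Primrec fun m => System.equivProd R n ((machineSystem hn c m).map ι) :=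
    Primrec.pair (Primrec.const 0) (Primrec.pair (Primrec.const 2) (Primrec.pair hstart
      (Primrec.const (((machineSystem hn c 0).map ι).edges))))
  exact (Primrec.of_equiv_symm (e := System.equivProd R n)).comp h

theorem exists_universal_code : ∃ c : ToPartrec.Code, ∀ p : Nat.Partrec.Code,
    (c.eval [Encodable.encode p]).Dom ↔ (p.eval 0).Dom := by
  have hf : Partrec fun m : ℕ => (Denumerable.ofNat Nat.Partrec.Code m).eval 0 :=
    Nat.Partrec.Code.eval_part.comp (Computable.ofNat _) (Computable.const 0)
  obtain ⟨c, hc⟩ := ToPartrec.Code.exists_code (Nat.Partrec'.part_iff₁.2 hf)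
  refine ⟨c, fun p => ?_⟩
  have := congrArg Part.Dom (hc ⟨[Encodable.encode p], rfl⟩)
  refine (iff_of_eq this).trans ?_
  simp [List.Vector.head]

/-- The separation problem is undecidable for every class of sets between the bounded and all convex
polyhedra, whenever the numerals include all integers. -/
theorem not_computablePred {R K : Type} [CommRing K] [LinearOrder K]
    [IsStrictOrderedRing K] [Archimedean K] [Primcodable R] {ι : ℤ → R} (hι : Primrec ι)
    {v : R → K} (hv : ∀ z, v (ι z) = z) {n : ℕ} (hn : 8 ≤ n) {D : Set (Set (Fin n → K))}
    (h₁ : boundedConvexPolyhedra K n ⊆ D) (h₂ : D ⊆ convexPolyhedra K n) :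
    ¬ ComputablePred fun S : System R n => S.HasSeparatingInvariant v D := by
  intro hD
  obtain ⟨c, hc⟩ := exists_universal_code
  refine ComputablePred.halting_problem 0 ?_
  have hcomp : Computable fun p : Nat.Partrec.Code =>
      (machineSystem hn c (Encodable.encode p)).map ι :=
    ((primrec_machineSystem hι hn c).comp Primrec.encode).to_comp
  refine ComputablePred.computable_of_manyOneReducible ⟨_, hcomp, fun p => ?_⟩ hD
  rw [System.hasSeparatingInvariant_map]
  simp only [hv]
  rw [machineSystem_iff hn c _ h₁ h₂, hc]

end PolyInv

theorem mainTheorem1 :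
    ∃ n₀ : ℕ, ∀ n : ℕ, n₀ ≤ n →
      ¬ ComputablePred (PolyInv.RatSeparation n (PolyInv.convexPolyhedra ℚ n)) ∧
      ¬ ComputablePred (PolyInv.RatSeparation n (PolyInv.boundedConvexPolyhedra ℚ n)) ∧
      ¬ ComputablePred (PolyInv.IntSeparation n (PolyInv.convexPolyhedra ℤ n)) ∧
      ¬ ComputablePred (PolyInv.IntSeparation n (PolyInv.boundedConvexPolyhedra ℤ n)) := by
  have hr : Primrec fun z : ℤ => (z, 0) := Primrec.pair Primrec.id (Primrec.const (0 : ℕ))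
  have hv : ∀ z : ℤ, PolyInv.ratValue (z, 0) = z := fun z => by simp [PolyInv.ratValue]
  have hb : ∀ {K : Type} [CommRing K] [LinearOrder K] (n : ℕ),
      PolyInv.boundedConvexPolyhedra K n ⊆ PolyInv.convexPolyhedra K n := fun n _ h => h.1
  exact ⟨8, fun n hn => ⟨PolyInv.not_computablePred hr hv hn (hb n) subset_rfl,
    PolyInv.not_computablePred hr hv hn subset_rfl (hb n),
    PolyInv.not_computablePred Primrec.id (fun _ => rfl) hn (hb n) subset_rfl,
    PolyInv.not_computablePred Primrec.id (fun _ => rfl) hn subset_rfl (hb n)⟩⟩
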